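/- Let $\kappa<1$ and $K>1$. There is a constant $C>0$, depending only on $\kappa$ and $K$, such that the following holds. Let $Y=\mu+\sigma\varepsilon$, where $\mu\in\mathbb{R}^n$, $\sigma>0$ and $\varepsilon=(\varepsilon_1,\dots,\varepsilon_n)$ has i.i.d. standard Gaussian components. Let $\{S_m, m\in\mathcal{M}\}$ be a finite or countable collection of linear subspaces of $\mathbb{R}^n$; denote by $\Pi_m$ the orthogonal projector onto $S_m$, and set $D_m=\dim S_m$, $N_m=n-D_m$, $\mu_m=\Pi_m\mu$ and $\hat\mu_m=\Pi_mY$. Let $\{L_m, m\in\mathcal{M}\}$ be nonnegative numbers with $$\Sigma'=\sum_{m\in\mathcal{M}}(D_m+1)e^{-L_m}<\infty .$$ For positive integers $D,N$ and $x\ge 0$ let $$\mathrm{Dkhi}[D,N,x]=\frac{1}{\mathbb{E}[X_D]}\,\mathbb{E}\Big[\Big(X_D-x\,\frac{X_N}{N}\Big)_+\Big],$$ where $X_D$ and $X_N$ are independent $\chi^2$ random variables with $D$ and $N$ degrees of freedom, and for $0<q\le 1$ let $\mathrm{EDkhi}[D,N,q]$ be the unique $x\ge 0$ with $\mathrm{Dkhi}[D,N,x]=q$.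 Define the penalty $$\mathrm{pen}_{K,\mathcal{L}}(m)=K\,\frac{N_m}{N_m-1}\,\mathrm{EDkhi}\big[D_m+1,N_m-1,e^{-L_m}\big],$$ and let $\hat m$ be a random index in $\mathcal{M}$ which, with probability $1$, minimizes over $m\in\mathcal{M}$ the criterion $$\|Y-\Pi_mY\|^2\Big(1+\frac{\mathrm{pen}_{K,\mathcal{L}}(m)}{n-D_m}\Big).$$ If $N_m\ge 7$ and $L_m\vee D_m\le\kappa n$ for all $m\in\mathcal{M}$, then $$\mathbb{E}\left[\frac{\|\mu-\hat\mu_{\hat m}\|^2}{\sigma^2}\right]\le C\left[\inf_{m\in\mathcal{M}}\left\{\frac{\|\mu-\mu_m\|^2}{\sigma^2}+D_m\vee L_m\right\}+\Sigma'\right]$$ (in particular the expectation is finite). -/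

import Mathlib

open MeasureTheory ProbabilityTheory

noncomputable section

/-- The chi-square distribution with `k` degrees of freedom: the law of the sum of the squares of
`k` independent standard Gaussian variables. -/
def chiSq (k : ℕ) : Measure ℝ :=
  (Measure.pi (fun _ : Fin k => gaussianReal 0 1)).map (fun z => ∑ i, z i ^ 2)

/-- `Dkhi[D, N, x] = E[(X_D - x X_N / N)_+] / E[X_D]`, with `X_D`, `X_N` independent chi-square
variables with `D` and `N` degrees of freedom (used for positive `D`, `N` and `x ≥ 0`). -/
def Dkhi (D N : ℕ) (x : ℝ) : ℝ :=
  (1 / ∫ u, u ∂(chiSq D)) *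
    ∫ p : ℝ × ℝ, max (p.1 - x * (p.2 / N)) 0 ∂((chiSq D).prod (chiSq N))

/-- `EDkhi[D, N, q]`, for `0 < q ≤ 1`: the solution `x ≥ 0` of `Dkhi[D, N, x] = q`. As
`x ↦ Dkhi[D, N, x]` is continuous and strictly decreasing from `1` to `0` on `[0, ∞)`, the set
below has exactly one element. -/
def EDkhi (D N : ℕ) (q : ℝ) : ℝ :=
  sInf {x : ℝ | 0 ≤ x ∧ Dkhi D N x = q}

/-- The dimension `D_m` of a model. -/
def modelDim {n : ℕ} (S : Submodule ℝ (EuclideanSpace ℝ (Fin n))) : ℕ :=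
  Module.finrank ℝ S

/-- `N_m = n - D_m` (no truncation occurs, since `D_m ≤ n`). -/
def modelCodim {n : ℕ} (S : Submodule ℝ (EuclideanSpace ℝ (Fin n))) : ℕ :=
  n - modelDim S

/-- The penalty `K * N_m / (N_m - 1) * EDkhi[D_m + 1, N_m - 1, exp (-L_m)]` of a model with
weight `L`. -/
def penKL {n : ℕ} (K : ℝ) (S : Submodule ℝ (EuclideanSpace ℝ (Fin n))) (L : ℝ) : ℝ :=
  K * ((modelCodim S : ℝ) / ((modelCodim S : ℝ) - 1)) *
    EDkhi (modelDim S + 1) (modelCodim S - 1) (Real.exp (-L))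

/-- The penalized least-squares criterion `‖y - Π_m y‖² (1 + pen / (n - D_m))`. -/
def crit {n : ℕ} (S : Submodule ℝ (EuclideanSpace ℝ (Fin n))) (pen : ℝ)
    (y : EuclideanSpace ℝ (Fin n)) : ℝ :=
  ‖y - S.starProjection y‖ ^ 2 * (1 + pen / (modelCodim S : ℝ))

/-- The observation `Y = μ + σ ε`, with `ε` given by its coordinates. -/
def observation {n : ℕ} {Ω : Type*} (μ : EuclideanSpace ℝ (Fin n)) (σ : ℝ)
    (ε : Fin n → Ω → ℝ) (ω : Ω) : EuclideanSpace ℝ (Fin n) :=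
  WithLp.toLp 2 (fun i => μ i + σ * ε i ω)

end

/-! ### Chi-square distributions -/

/-! For each model take a space `T` of dimension `D_m + 1` containing both `S_m` and `μ`. Expanding
the residual and applying Young's inequality bounds `(1 - 1/K)` times the loss by the residual minus
`σ²‖ε‖²` plus `K σ²‖Π_T ε‖²` (`loss_le_residual_add`). The residual is at least `σ²‖ε - Π_T ε‖²`, so
the penalty absorbs `K σ² x ‖ε - Π_T ε‖² / (N_m - 1)`, where `x` is the `EDkhi` value
(`loss_le_crit_add`). The two squared norms are independent chi-squares with `D_m + 1` and `N_m - 1`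
degrees of freedom (`hasLaw_norm_sq_starProjection`), so by the choice of `x` the positive part of
what is not absorbed has mean `K (D_m + 1) exp (-L_m)`.

The selected index is random, but a nonnegative term at that index is at most the sum over all
indices, which costs `K Σ'` (`integrable_select_and_integral_le`). There remains the mean criterion
of an arbitrary competitor minus `n`, namely `bias (1 + pen / N_m) + pen - D_m`. A Chernoff bound
(`Dkhi_le_exp`) gives `pen = O(L_m + D_m + 2)` and `pen / N_m = O(1)` (`penKL_spec`). -/

lemma integrable_sq_gaussianReal : Integrable (fun x : ℝ => x ^ 2) (gaussianReal 0 1) := by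
  have h : MemLp id 2 (gaussianReal 0 1) := IsGaussian.memLp_two_id
  simpa using h.integrable_sq

lemma integral_sq_gaussianReal : ∫ x, x ^ 2 ∂(gaussianReal 0 1) = 1 := by
  have h := variance_fun_id_gaussianReal (μ := 0) (v := 1)
  rw [variance_of_integral_eq_zero (by fun_prop) integral_id_gaussianReal] at h
  simpa using h

lemma gaussianPDFReal_mul_exp_sq (l x : ℝ) :
    gaussianPDFReal 0 1 x * Real.exp (l * x ^ 2) =
      (√(2 * Real.pi))⁻¹ * Real.exp (-(1 / 2 - l) * x ^ 2) := by
  rw [gaussianPDFReal, mul_assoc, ← Real.exp_add]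
  simp only [NNReal.coe_one, mul_one, sub_zero]
  congr 2
  ring

lemma integrable_exp_sq_gaussianReal {l : ℝ} (hl : l < 1 / 2) :
    Integrable (fun x : ℝ => Real.exp (l * x ^ 2)) (gaussianReal 0 1) := by
  rw [gaussianReal_of_var_ne_zero _ one_ne_zero,
    integrable_withDensity_iff_integrable_smul₀' (by fun_prop)
      (ae_of_all _ fun _ => gaussianPDF_lt_top)]
  simp only [toReal_gaussianPDF, smul_eq_mul, gaussianPDFReal_mul_exp_sq]
  exact (integrable_exp_neg_mul_sq (by linarith)).const_mul _

lemma integral_exp_sq_gaussianReal {l : ℝ} (hl : l < 1 / 2) :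
    ∫ x, Real.exp (l * x ^ 2) ∂(gaussianReal 0 1) = (√(1 - 2 * l))⁻¹ := by
  rw [integral_gaussianReal_eq_integral_smul one_ne_zero]
  simp only [smul_eq_mul, gaussianPDFReal_mul_exp_sq]
  rw [integral_const_mul, integral_gaussian, ← Real.sqrt_inv, ← Real.sqrt_mul (by positivity),
    ← Real.sqrt_inv]
  have := Real.pi_pos
  have h : 1 - 2 * l ≠ 0 := by linarith
  have h' : 1 / 2 - l ≠ 0 := by linarith
  congr 1
  field_simp

lemma measurable_sum_sq (k : ℕ) : Measurable (fun z : Fin k → ℝ => ∑ i, z i ^ 2) := by fun_prop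

instance isProbabilityMeasure_chiSq (k : ℕ) : IsProbabilityMeasure (chiSq k) :=
  Measure.isProbabilityMeasure_map (measurable_sum_sq k).aemeasurable

lemma chiSq_nonneg (k : ℕ) : ∀ᵐ u ∂(chiSq k), 0 ≤ u := by
  rw [chiSq, ae_map_iff (measurable_sum_sq k).aemeasurable measurableSet_Ici]
  exact ae_of_all _ fun z => Finset.sum_nonneg fun i _ => sq_nonneg _

lemma integrable_id_chiSq (k : ℕ) : Integrable (fun u => u) (chiSq k) := by
  rw [chiSq, integrable_map_measure (by fun_prop) (measurable_sum_sq k).aemeasurable]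
  exact integrable_finsetSum _ fun i _ =>
    integrable_comp_eval (i := i) (μ := fun _ : Fin k => gaussianReal 0 1)
      (f := fun x : ℝ => x ^ 2) integrable_sq_gaussianReal

lemma integral_id_chiSq (k : ℕ) : ∫ u, u ∂(chiSq k) = k := by
  rw [chiSq, integral_map (measurable_sum_sq k).aemeasurable (by fun_prop), integral_finsetSum]
  · have (i : Fin k) :
        ∫ z : Fin k → ℝ, z i ^ 2 ∂(Measure.pi fun _ => gaussianReal 0 1) = 1 := by
      rw [integral_comp_eval (i := i) (μ := fun _ : Fin k => gaussianReal 0 1)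
        (f := fun x : ℝ => x ^ 2) (by fun_prop), integral_sq_gaussianReal]
    simp [this]
  · exact fun i _ => integrable_comp_eval (i := i) (μ := fun _ : Fin k => gaussianReal 0 1)
      (f := fun x : ℝ => x ^ 2) integrable_sq_gaussianReal

lemma integrable_exp_chiSq (k : ℕ) {l : ℝ} (hl : l < 1 / 2) :
    Integrable (fun u => Real.exp (l * u)) (chiSq k) := by
  rw [chiSq, integrable_map_measure (by fun_prop) (measurable_sum_sq k).aemeasurable]
  simp only [Function.comp_def, Finset.mul_sum, Real.exp_sum]
  exact Integrable.fintype_prod (f := fun _ x => Real.exp (l * x ^ 2))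
    fun _ => integrable_exp_sq_gaussianReal hl

lemma integral_exp_chiSq (k : ℕ) {l : ℝ} (hl : l < 1 / 2) :
    ∫ u, Real.exp (l * u) ∂(chiSq k) = (√(1 - 2 * l))⁻¹ ^ k := by
  rw [chiSq, integral_map (measurable_sum_sq k).aemeasurable (by fun_prop)]
  simp only [Finset.mul_sum, Real.exp_sum]
  rw [integral_fintype_prod_eq_pow (fun x : ℝ => Real.exp (l * x ^ 2)),
    integral_exp_sq_gaussianReal hl, Fintype.card_fin]

/-! ### The functions `Dkhi` and `EDkhi` -/

lemma integrable_max_chiSq (D N : ℕ) (x : ℝ) :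
    Integrable (fun p : ℝ × ℝ => max (p.1 - x * (p.2 / N)) 0) ((chiSq D).prod (chiSq N)) :=
  (((integrable_id_chiSq D).comp_fst _).sub
    ((((integrable_id_chiSq N).comp_snd _).div_const _).const_mul x)).pos_part

lemma integral_max_chiSq (D N : ℕ) (hD : 0 < D) (x : ℝ) :
    ∫ p : ℝ × ℝ, max (p.1 - x * (p.2 / N)) 0 ∂((chiSq D).prod (chiSq N)) = D * Dkhi D N x := by
  have : (D : ℝ) ≠ 0 := by positivity
  rw [Dkhi, integral_id_chiSq]
  field_simp

/-- The positive part is 1-Lipschitz, so the unnormalised integral is Lipschitz in `x` with constant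
`E|X_N / N|`. -/
lemma continuous_Dkhi (D N : ℕ) : Continuous (Dkhi D N) := by
  refine continuous_const.mul ?_
  have hint : Integrable (fun p : ℝ × ℝ => |p.2 / N|) ((chiSq D).prod (chiSq N)) :=
    (((integrable_id_chiSq N).comp_snd (chiSq D)).div_const _).abs
  refine LipschitzWith.continuous (K := Real.toNNReal
    (∫ p : ℝ × ℝ, |p.2 / N| ∂((chiSq D).prod (chiSq N)))) (LipschitzWith.of_dist_le_mul ?_)
  intro x y
  rw [Real.coe_toNNReal _ (integral_nonneg fun _ => abs_nonneg _), Real.dist_eq, Real.dist_eq,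
    ← integral_sub (integrable_max_chiSq D N x) (integrable_max_chiSq D N y), ← integral_mul_const]
  refine (abs_integral_le_integral_abs).trans (integral_mono
    ((integrable_max_chiSq D N x).sub (integrable_max_chiSq D N y)).abs
    (hint.mul_const _) fun p => ?_)
  refine (abs_max_sub_max_le_abs _ _ _).trans_eq ?_
  rw [← abs_mul, abs_sub_comm]
  congr 1
  ring

lemma Dkhi_zero (D N : ℕ) (hD : 0 < D) : Dkhi D N 0 = 1 := by
  have h : ∫ p : ℝ × ℝ, max (p.1 - 0 * (p.2 / N)) 0 ∂((chiSq D).prod (chiSq N)) = D := by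
    rw [← integral_id_chiSq D]
    refine Eq.trans (integral_congr_ae (g := fun p : ℝ × ℝ => p.1) ?_) ?_
    · filter_upwards [Measure.quasiMeasurePreserving_fst.ae (chiSq_nonneg D)] with p hp
      simpa using hp
    · simpa using integral_fun_fst (μ := chiSq D) (ν := chiSq N) (fun u : ℝ => u)
  have : (D : ℝ) ≠ 0 := by positivity
  rw [Dkhi, h, integral_id_chiSq]
  field_simp

/-- This is `t + 1 ≤ exp t` at `t = u / 4 - 1`. The rate `1/4` lies below `1/2`, where chi-square
exponential moments are finite. -/
lemma max_zero_le_exp (u : ℝ) : max u 0 ≤ 4 / Real.exp 1 * Real.exp (u / 4) := by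
  refine max_le ?_ (by positivity)
  have := Real.add_one_le_exp (u / 4 - 1)
  rw [Real.exp_sub] at this
  calc u ≤ 4 * (Real.exp (u / 4) / Real.exp 1) := by linarith
    _ = _ := by ring

/-- A Chernoff bound for `Dkhi`. -/
lemma Dkhi_le (D N : ℕ) (hD : 0 < D) {x : ℝ} (hx : 0 ≤ x) :
    Dkhi D N x ≤ 4 / Real.exp 1 * ((√(1 / 2))⁻¹ ^ D * (√(1 + x / (2 * N)))⁻¹ ^ N) := by
  have h1 : (1 / 4 : ℝ) < 1 / 2 := by norm_num
  have h2 : -(x / (4 * N)) < 1 / 2 := by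
    have : 0 ≤ x / (4 * N) := by positivity
    linarith
  have hint : Integrable (fun p : ℝ × ℝ => 4 / Real.exp 1 *
      (Real.exp (1 / 4 * p.1) * Real.exp (-(x / (4 * N)) * p.2))) ((chiSq D).prod (chiSq N)) :=
    ((integrable_exp_chiSq D h1).mul_prod (integrable_exp_chiSq N h2)).const_mul _
  have hle := integral_mono (integrable_max_chiSq D N x) hint (fun p => by
    refine (max_zero_le_exp _).trans_eq ?_
    rw [← Real.exp_add]
    congr 2
    ring)
  rw [integral_max_chiSq D N hD, integral_const_mul,
    integral_prod_mul (fun u => Real.exp (1 / 4 * u)) (fun v => Real.exp (-(x / (4 * N)) * v)),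
    integral_exp_chiSq D h1, integral_exp_chiSq N h2] at hle
  have hnn : 0 ≤ Dkhi D N x := by
    rw [Dkhi, integral_id_chiSq]
    exact mul_nonneg (by positivity) (integral_nonneg fun _ => le_max_right _ _)
  have hD1 : (1 : ℝ) ≤ D := by exact_mod_cast hD
  -- The normalisation `1 / E[X_D] = 1 / D` is simply discarded, as `D ≥ 1`.
  calc Dkhi D N x ≤ D * Dkhi D N x := by nlinarith
    _ ≤ _ := hle
    _ = _ := by
      congr 4
      · norm_num
      · congr 2
        ring

/-- Strict monotonicity of `Dkhi` is not needed: the solution set is nonempty by the intermediate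
value theorem and closed by continuity, so it contains its infimum. -/
lemma EDkhi_spec (D N : ℕ) (hD : 0 < D) {q x : ℝ} (hq : q ≤ 1) (hx : 0 ≤ x)
    (hxq : Dkhi D N x ≤ q) :
    0 ≤ EDkhi D N q ∧ Dkhi D N (EDkhi D N q) = q ∧ EDkhi D N q ≤ x := by
  obtain ⟨y, hy, hyq⟩ := intermediate_value_Icc' hx (continuous_Dkhi D N).continuousOn
    (show q ∈ Set.Icc (Dkhi D N x) (Dkhi D N 0) from ⟨hxq, by rwa [Dkhi_zero D N hD]⟩)
  have hbdd : BddBelow {x : ℝ | 0 ≤ x ∧ Dkhi D N x = q} := ⟨0, fun z hz => hz.1⟩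
  have hclosed : IsClosed {x : ℝ | 0 ≤ x ∧ Dkhi D N x = q} :=
    isClosed_Ici.inter (isClosed_eq (continuous_Dkhi D N) continuous_const)
  have hmem := hclosed.csInf_mem ⟨y, hy.1, hyq⟩ hbdd
  exact ⟨hmem.1, hmem.2, (csInf_le hbdd ⟨hy.1, hyq⟩).trans hy.2⟩

/-- With `A = L + D + 1`, the factor `(1 + x / (2N))^(-N/2)` of the Chernoff bound is at most `exp
(-A)` once `1 + x / (2N) ≥ exp t`, `t = 2A / N`. Since `exp t ≤ 1 + t exp t` and `t ≤ 2c`, the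
choice `x = 4 A exp (2c)` suffices. The part `D + 1` of `A` pays for the prefactor `(4 / e) √2 ^ D ≤
e ^ (D + 1)`. -/
lemma Dkhi_le_exp (D N : ℕ) (hD : 0 < D) (hN : 0 < N) {L c : ℝ} (hL : 0 ≤ L)
    (hc : L + D + 1 ≤ c * N) :
    Dkhi D N (4 * (L + D + 1) * Real.exp (2 * c)) ≤ Real.exp (-L) := by
  have hN' : (0 : ℝ) < N := by exact_mod_cast hN
  set A := L + D + 1 with hA
  have hA0 : 0 < A := by positivity
  refine (Dkhi_le D N hD (by positivity)).trans ?_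
  have hlog : Real.exp (2 * A / N) ≤ 1 + 4 * A * Real.exp (2 * c) / (2 * N) := by
    have h1 := Real.add_one_le_exp (-(2 * A / N))
    have h2 : Real.exp (2 * A / N) * Real.exp (-(2 * A / N)) = 1 := by
      rw [← Real.exp_add]; simp
    have h3 : Real.exp (2 * A / N) ≤ Real.exp (2 * c) := by
      apply Real.exp_le_exp.2
      rw [div_le_iff₀ hN']
      linarith
    have h4 : 0 < 2 * A / N := by positivity
    calc Real.exp (2 * A / N) ≤ 1 + 2 * A / N * Real.exp (2 * A / N) := by
          nlinarith [Real.exp_pos (2 * A / N)]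
      _ ≤ 1 + 2 * A / N * Real.exp (2 * c) := by gcongr
      _ = _ := by field_simp; ring
  have hpow : (√(1 + 4 * A * Real.exp (2 * c) / (2 * N)))⁻¹ ^ N ≤ Real.exp (-A) := by
    calc _ ≤ (√(Real.exp (2 * A / N)))⁻¹ ^ N := by gcongr
      _ = Real.exp (-A) := by
        rw [← Real.exp_half, ← Real.exp_neg, ← Real.exp_nat_mul]
        congr 1
        field_simp
  have he : (2 : ℝ) ≤ Real.exp 1 := by
    have := Real.add_one_le_exp 1
    linarith
  have h2 : (√(1 / 2 : ℝ))⁻¹ ≤ Real.exp 1 := by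
    refine le_trans ?_ he
    rw [inv_le_comm₀ (by positivity) (by norm_num)]
    apply Real.le_sqrt_of_sq_le
    norm_num
  have h4 : 4 / Real.exp 1 ≤ Real.exp 1 := by
    rw [div_le_iff₀ (by positivity)]
    nlinarith
  calc _ ≤ Real.exp 1 * (Real.exp 1 ^ D * Real.exp (-A)) := by gcongr
    _ = Real.exp (-L) := by
      rw [← Real.exp_nat_mul, ← Real.exp_add, ← Real.exp_add]
      congr 1
      rw [hA]
      ring

/-! ### Projections of a standard Gaussian vector -/

/-- The product measure indexed by a sum type is a product of two product measures. -/
lemma map_sumElim_prod_pi {ι κ α : Type*} [Fintype ι] [Fintype κ] [MeasurableSpace α]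
    (ν : Measure α) [SigmaFinite ν] :
    ((Measure.pi fun _ : ι => ν).prod (Measure.pi fun _ : κ => ν)).map
      (fun p : (ι → α) × (κ → α) => Sum.elim p.1 p.2) = Measure.pi fun _ : ι ⊕ κ => ν := by
  have hm : Measurable (fun p : (ι → α) × (κ → α) => (Sum.elim p.1 p.2 : ι ⊕ κ → α)) := by
    refine measurable_pi_iff.2 ?_
    rintro (i | i) <;> simp only [Sum.elim_inl, Sum.elim_inr] <;> fun_prop
  refine (Measure.pi_eq fun s hs => ?_).symm
  rw [Measure.map_apply hm (MeasurableSet.univ_pi hs)]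
  have : (fun p : (ι → α) × (κ → α) => (Sum.elim p.1 p.2 : ι ⊕ κ → α)) ⁻¹' Set.univ.pi s =
      (Set.univ.pi fun i => s (Sum.inl i)) ×ˢ (Set.univ.pi fun i => s (Sum.inr i)) := by
    ext p
    simp [Set.mem_pi, Sum.forall]
  rw [this, Measure.prod_prod, Measure.pi_pi, Measure.pi_pi, Fintype.prod_sum_type]

section Projection

variable {E : Type*} [NormedAddCommGroup E] [InnerProductSpace ℝ E] [FiniteDimensional ℝ E]

omit [FiniteDimensional ℝ E] in
lemma norm_sq_sum_smul_orthonormalBasis {ι : Type*} [Fintype ι] {T : Submodule ℝ E}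
    (b : OrthonormalBasis ι ℝ T) (x : ι → ℝ) : ‖∑ i, x i • (b i : E)‖ ^ 2 = ∑ i, x i ^ 2 := by
  have h : ∑ i, x i • (b i : E) = ((b.repr.symm (WithLp.toLp 2 x) : T) : E) := by
    rw [← b.sum_repr_symm]
    simp
  rw [h, ← Submodule.coe_norm, LinearIsometryEquiv.norm_map, EuclideanSpace.real_norm_sq_eq]

/-- The coordinates of a standard Gaussian vector in an orthonormal basis adapted to `T ⊕ Tᗮ` are
i.i.d. standard Gaussian, and each squared norm uses its own block of them. -/
lemma hasLaw_norm_sq_starProjection [MeasurableSpace E] [BorelSpace E] (T : Submodule ℝ E)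
    {d k : ℕ} (hd : Module.finrank ℝ T = d) (hk : Module.finrank ℝ Tᗮ = k) :
    HasLaw (fun e => (‖T.starProjection e‖ ^ 2, ‖e - T.starProjection e‖ ^ 2))
      ((chiSq d).prod (chiSq k)) (stdGaussian E) := by
  let b₁ := (stdOrthonormalBasis ℝ T).reindex (finCongr hd)
  let b₂ := (stdOrthonormalBasis ℝ Tᗮ).reindex (finCongr hk)
  let b : OrthonormalBasis (Fin d ⊕ Fin k) ℝ E := (b₁.prod b₂).map T.orthogonalDecomposition.symm
  have hb₁ (i : Fin d) : b (Sum.inl i) = b₁ i := by simp [b]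
  have hb₂ (i : Fin k) : b (Sum.inr i) = b₂ i := by simp [b]
  have hf : Measurable
      (fun e : E => (‖T.starProjection e‖ ^ 2, ‖e - T.starProjection e‖ ^ 2)) := by fun_prop
  refine ⟨hf.aemeasurable, ?_⟩
  have hm : Measurable
      (fun p : (Fin d → ℝ) × (Fin k → ℝ) => (Sum.elim p.1 p.2 : Fin d ⊕ Fin k → ℝ)) := by
    refine measurable_pi_iff.2 ?_
    rintro (i | i) <;> simp only [Sum.elim_inl, Sum.elim_inr] <;> fun_prop
  have hs : Measurable (fun x : Fin d ⊕ Fin k → ℝ => ∑ i, x i • b i) := by fun_prop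
  rw [stdGaussian_eq_map_pi_orthonormalBasis b, ← map_sumElim_prod_pi,
    Measure.map_map hs hm, Measure.map_map hf (hs.comp hm), chiSq, chiSq,
    Measure.map_prod_map _ _ (measurable_sum_sq d) (measurable_sum_sq k)]
  congr 1
  ext1 p
  have h₁ : ∑ i, p.1 i • (b₁ i : E) ∈ T :=
    Submodule.sum_mem _ fun i _ => T.smul_mem _ (b₁ i).2
  have h₂ : ∑ i, p.2 i • (b₂ i : E) ∈ Tᗮ :=
    Submodule.sum_mem _ fun i _ => Tᗮ.smul_mem _ (b₂ i).2
  have hsum : ∑ i, (Sum.elim p.1 p.2 : Fin d ⊕ Fin k → ℝ) i • b i =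
      ∑ i, p.1 i • (b₁ i : E) + ∑ i, p.2 i • (b₂ i : E) := by
    simp [Fintype.sum_sum_type, hb₁, hb₂]
  have hproj := Submodule.eq_starProjection_of_mem_orthogonal' h₁ h₂ hsum
  simp only [Function.comp_apply, Prod.map]
  rw [hproj, hsum, add_sub_cancel_left, norm_sq_sum_smul_orthonormalBasis,
    norm_sq_sum_smul_orthonormalBasis]

/-- A proper subspace can be enlarged by one dimension so as to contain a given vector. -/
lemma exists_le_mem_finrank_eq_add_one (S : Submodule ℝ E)
    (hS : Module.finrank ℝ S < Module.finrank ℝ E) (v : E) :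
    ∃ T : Submodule ℝ E, S ≤ T ∧ v ∈ T ∧ Module.finrank ℝ T = Module.finrank ℝ S + 1 := by
  by_cases hv : v ∈ S
  -- The dimension must grow by exactly one even here, to match the `D_m + 1` degrees of freedom in
  -- the penalty; any outside vector will do.
  · obtain ⟨w, hw⟩ : ∃ w, w ∉ S := by
      by_contra! h
      rw [(Submodule.eq_top_iff' (p := S)).2 h, finrank_top] at hS
      exact lt_irrefl _ hS
    exact ⟨S ⊔ Submodule.span ℝ {w}, le_sup_left, Submodule.mem_sup_left hv,
      Submodule.finrank_sup_span_singleton hw⟩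
  · exact ⟨S ⊔ Submodule.span ℝ {v}, le_sup_left,
      Submodule.mem_sup_right (Submodule.mem_span_singleton_self v),
      Submodule.finrank_sup_span_singleton hv⟩

lemma norm_sub_sq_eq_add_of_mem (S : Submodule ℝ E) (x : E) {z : E} (hz : z ∈ S) :
    ‖x - z‖ ^ 2 = ‖x - S.starProjection x‖ ^ 2 + ‖S.starProjection x - z‖ ^ 2 := by
  have h : inner ℝ (x - S.starProjection x) (S.starProjection x - z) = 0 :=
    S.starProjection_inner_eq_zero x _ (S.sub_mem (S.starProjection_apply_mem x) hz)
  have := norm_add_sq_real (x - S.starProjection x) (S.starProjection x - z)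
  rw [h] at this
  simpa using this

lemma norm_sub_starProjection_sq_le (S : Submodule ℝ E) (x : E) {z : E} (hz : z ∈ S) :
    ‖x - S.starProjection x‖ ^ 2 ≤ ‖x - z‖ ^ 2 := by
  rw [norm_sub_sq_eq_add_of_mem S x hz]
  nlinarith [sq_nonneg ‖S.starProjection x - z‖]

/-- The basic inequality: the loss of a projection estimator is controlled by its residual and by
the projection of the noise on a space that contains the model and the mean. -/
lemma loss_le_residual_add {S T : Submodule ℝ E} (hST : S ≤ T) {μ : E} (hμ : μ ∈ T) (e : E)
    {σ K : ℝ} (hK : 1 < K) :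
    (1 - 1 / K) * ‖μ - S.starProjection (μ + σ • e)‖ ^ 2 ≤
      ‖μ + σ • e - S.starProjection (μ + σ • e)‖ ^ 2 - σ ^ 2 * ‖e‖ ^ 2 +
        K * (σ ^ 2 * ‖T.starProjection e‖ ^ 2) := by
  set Y := μ + σ • e with hY
  set a := μ - S.starProjection Y with ha
  have haT : a ∈ T := T.sub_mem hμ (hST (S.starProjection_apply_mem _))
  have hres : ‖Y - S.starProjection Y‖ ^ 2 = ‖a‖ ^ 2 + 2 * (σ * inner ℝ a e) + σ ^ 2 * ‖e‖ ^ 2 := by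
    have : Y - S.starProjection Y = a + σ • e := by rw [ha, hY]; abel
    rw [this, norm_add_sq_real, inner_smul_right, norm_smul, mul_pow, Real.norm_eq_abs, sq_abs]
  have hin : inner ℝ a e = inner ℝ a (T.starProjection e) := by
    rw [← Submodule.inner_starProjection_left_eq_right, Submodule.starProjection_eq_self_iff.2 haT]
  have hcs : |inner ℝ a (T.starProjection e)| ≤ ‖a‖ * ‖T.starProjection e‖ :=
    abs_real_inner_le_norm _ _
  rw [hres, hin]
  set r := inner ℝ a (T.starProjection e)
  have hK0 : 0 < K := by linarith
  -- Young's inequality for the cross term `2σ⟨a, Π_T e⟩`, written as a nonnegative square.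
  have h1 : 0 ≤ 1 / K * ‖a + (K * σ) • T.starProjection e‖ ^ 2 := by positivity
  rw [norm_add_sq_real, inner_smul_right, norm_smul, mul_pow, Real.norm_eq_abs, sq_abs] at h1
  have h2 : 1 / K * (‖a‖ ^ 2 + 2 * (K * σ * r) + (K * σ) ^ 2 * ‖T.starProjection e‖ ^ 2) =
      1 / K * ‖a‖ ^ 2 + 2 * (σ * r) + K * (σ ^ 2 * ‖T.starProjection e‖ ^ 2) := by
    field_simp
  linarith

end Projection

/-! ### Randomly selected indices -/

lemma aemeasurable_select {Ω M : Type*} [MeasurableSpace Ω] [Countable M] {P : Measure Ω}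
    {mhat : Ω → M} (hmhat : ∀ m, MeasurableSet (mhat ⁻¹' {m})) {f : M → Ω → ℝ}
    (hf : ∀ m, AEMeasurable (f m) P) : AEMeasurable (fun ω => f (mhat ω) ω) P := by
  have hU : ⋃ m, mhat ⁻¹' {m} = Set.univ := by
    ext ω
    simp
  rw [← Measure.restrict_univ (μ := P), ← hU, aemeasurable_iUnion_iff]
  intro m
  refine (hf m).restrict.congr ?_
  filter_upwards [ae_restrict_mem (hmhat m)] with ω hω
  rw [show mhat ω = m from hω]

/-- Pointwise, the selected term is at most the sum of all terms. Working with `lintegral` lets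
Tonelli deliver integrability along with the bound. -/
lemma integrable_select_and_integral_le {Ω M : Type*} [MeasurableSpace Ω] [Countable M]
    {P : Measure Ω} {mhat : Ω → M} (hmhat : ∀ m, MeasurableSet (mhat ⁻¹' {m})) {f : M → Ω → ℝ}
    (hf : ∀ m, Integrable (f m) P) (hf0 : ∀ m ω, 0 ≤ f m ω)
    (hs : Summable fun m => ∫ ω, f m ω ∂P) :
    Integrable (fun ω => f (mhat ω) ω) P ∧
      ∫ ω, f (mhat ω) ω ∂P ≤ ∑' m, ∫ ω, f m ω ∂P := by
  have hmeas : AEStronglyMeasurable (fun ω => f (mhat ω) ω) P :=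
    (aemeasurable_select hmhat fun m => (hf m).aemeasurable).aestronglyMeasurable
  have hnn : 0 ≤ᵐ[P] fun ω => f (mhat ω) ω := ae_of_all _ fun ω => hf0 _ ω
  have hle : ∫⁻ ω, ENNReal.ofReal (f (mhat ω) ω) ∂P ≤
      ENNReal.ofReal (∑' m, ∫ ω, f m ω ∂P) := by
    calc _ ≤ ∫⁻ ω, ∑' m, ENNReal.ofReal (f m ω) ∂P :=
          lintegral_mono fun ω => ENNReal.le_tsum (f := fun m => ENNReal.ofReal (f m ω)) (mhat ω)
      _ = ∑' m, ∫⁻ ω, ENNReal.ofReal (f m ω) ∂P :=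
          lintegral_tsum fun m => (hf m).aemeasurable.ennreal_ofReal
      _ = ∑' m, ENNReal.ofReal (∫ ω, f m ω ∂P) := by
          congr 1
          ext m
          rw [ofReal_integral_eq_lintegral_ofReal (hf m) (ae_of_all _ (hf0 m))]
      _ = _ := (ENNReal.ofReal_tsum_of_nonneg (fun m => integral_nonneg (hf0 m)) hs).symm
  refine ⟨(lintegral_ofReal_ne_top_iff_integrable hmeas hnn).1
    (ne_top_of_le_ne_top ENNReal.ofReal_ne_top hle), ?_⟩
  rw [integral_eq_lintegral_of_nonneg_ae hnn hmeas]
  refine (ENNReal.toReal_mono ENNReal.ofReal_ne_top hle).trans_eq ?_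
  exact ENNReal.toReal_ofReal (tsum_nonneg fun m => integral_nonneg (hf0 m))

/-! ### The penalty -/

lemma modelDim_add_modelCodim {n : ℕ} (S : Submodule ℝ (EuclideanSpace ℝ (Fin n))) :
    modelDim S + modelCodim S = n := by
  have := Submodule.finrank_le S
  rw [finrank_euclideanSpace_fin] at this
  rw [modelCodim, modelDim]
  omega

lemma penKL_spec {n : ℕ} (S : Submodule ℝ (EuclideanSpace ℝ (Fin n))) {K κ L : ℝ} (hK : 1 < K)
    (hκ : κ < 1) (hL : 0 ≤ L) (hN : 7 ≤ modelCodim S) (hmax : max L (modelDim S) ≤ κ * n) :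
    0 ≤ penKL K S L ∧
    penKL K S L ≤ 8 * K * Real.exp (7 / (1 - κ)) * (L + modelDim S + 2) ∧
    penKL K S L / modelCodim S ≤ 8 * K * Real.exp (7 / (1 - κ)) * (3 / (1 - κ)) ∧
    Dkhi (modelDim S + 1) (modelCodim S - 1)
      (EDkhi (modelDim S + 1) (modelCodim S - 1) (Real.exp (-L))) = Real.exp (-L) := by
  have hdim := modelDim_add_modelCodim S
  rw [penKL]
  generalize modelDim S = D at *
  generalize modelCodim S = N at *
  have hnR : (D : ℝ) + N = n := by exact_mod_cast hdim
  have hN7 : (7 : ℝ) ≤ N := by exact_mod_cast hN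
  have hD0 : (0 : ℝ) ≤ D := by positivity
  have hLn := (le_max_left _ _).trans hmax
  have hDn := (le_max_right _ _).trans hmax
  have hκ' : 0 < 1 - κ := by linarith
  have hn7 : (7 : ℝ) ≤ n := by linarith
  have hκn : κ * n ≤ n := by nlinarith
  have hNn : (1 - κ) * n ≤ N := by linarith
  have hsum : L + D + 2 ≤ 3 * n := by linarith
  have hsumN : L + D + 2 ≤ 3 / (1 - κ) * N := by
    rw [div_mul_eq_mul_div, le_div_iff₀ hκ']
    nlinarith
  have hcast : ((N - 1 : ℕ) : ℝ) = N - 1 := by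
    rw [Nat.cast_sub (by omega), Nat.cast_one]
  -- From `L + D + 2 ≤ 3n` and `(1 - κ) n ≤ N` it suffices that `3N ≤ 7/2 (N - 1)`, which is exactly
  -- `N ≥ 7`.
  have hbound : L + ((D + 1 : ℕ) : ℝ) + 1 ≤ 7 / 2 / (1 - κ) * ((N - 1 : ℕ) : ℝ) := by
    rw [hcast, Nat.cast_add, Nat.cast_one, div_mul_eq_mul_div, le_div_iff₀ hκ']
    nlinarith
  have hx := Dkhi_le_exp (D + 1) (N - 1) (by omega) (by omega) hL hbound
  obtain ⟨h0, hq, hle⟩ := EDkhi_spec (D + 1) (N - 1) (by omega)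
    (Real.exp_le_one_iff.2 (by linarith)) (by positivity) hx
  have hc : 2 * (7 / 2 / (1 - κ)) = 7 / (1 - κ) := by ring
  rw [hc] at hle
  set x := EDkhi (D + 1) (N - 1) (Real.exp (-L))
  push_cast at hle
  have hratio : (N : ℝ) / (N - 1) ≤ 2 := by
    rw [div_le_iff₀ (by linarith)]
    linarith
  have hratio0 : 0 ≤ (N : ℝ) / (N - 1) := div_nonneg (by linarith) (by linarith)
  have hpen : K * ((N : ℝ) / (N - 1)) * x ≤ 8 * K * Real.exp (7 / (1 - κ)) * (L + D + 2) := by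
    calc K * ((N : ℝ) / (N - 1)) * x
        ≤ K * 2 * (4 * (L + (D + 1) + 1) * Real.exp (7 / (1 - κ))) := by gcongr
      _ = _ := by ring
  refine ⟨by positivity, hpen, ?_, hq⟩
  rw [div_le_iff₀ (by linarith), mul_assoc _ (3 / (1 - κ))]
  exact hpen.trans (by gcongr)

/-! ### Integrals of projections of the noise -/

section Noise

variable {n : ℕ} {Ω : Type*} [MeasurableSpace Ω] {P : Measure Ω}
  {e : Ω → EuclideanSpace ℝ (Fin n)}

lemma hasLaw_stdGaussian_of_iIndepFun [IsProbabilityMeasure P] {ε : Fin n → Ω → ℝ}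
    (hε : ∀ i, HasLaw (ε i) (gaussianReal 0 1) P) (hind : iIndepFun ε P) :
    HasLaw (fun ω => WithLp.toLp 2 fun i => ε i ω) (stdGaussian (EuclideanSpace ℝ (Fin n))) P :=
  HasLaw.fun_comp (Y := WithLp.toLp 2) ⟨by fun_prop, map_pi_eq_stdGaussian⟩ (hind.hasLaw_pi hε)

lemma hasLaw_noise_projection (he : HasLaw e (stdGaussian (EuclideanSpace ℝ (Fin n))) P)
    (T : Submodule ℝ (EuclideanSpace ℝ (Fin n))) {d k : ℕ} (hd : Module.finrank ℝ T = d)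
    (hk : d + k = n) :
    HasLaw (fun ω => (‖T.starProjection (e ω)‖ ^ 2, ‖e ω - T.starProjection (e ω)‖ ^ 2))
      ((chiSq d).prod (chiSq k)) P := by
  have hk' : Module.finrank ℝ Tᗮ = k := by
    have := T.finrank_add_finrank_orthogonal
    rw [finrank_euclideanSpace_fin] at this
    omega
  exact HasLaw.fun_comp (hasLaw_norm_sq_starProjection T hd hk') he

lemma integral_noise_projection (he : HasLaw e (stdGaussian (EuclideanSpace ℝ (Fin n))) P)
    (T : Submodule ℝ (EuclideanSpace ℝ (Fin n))) {d k : ℕ} (hd : Module.finrank ℝ T = d)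
    (hk : d + k = n) {f : ℝ × ℝ → ℝ} (hf : Integrable f ((chiSq d).prod (chiSq k))) :
    Integrable (fun ω => f (‖T.starProjection (e ω)‖ ^ 2, ‖e ω - T.starProjection (e ω)‖ ^ 2)) P ∧
      ∫ ω, f (‖T.starProjection (e ω)‖ ^ 2, ‖e ω - T.starProjection (e ω)‖ ^ 2) ∂P =
        ∫ p, f p ∂((chiSq d).prod (chiSq k)) := by
  have h := hasLaw_noise_projection he T hd hk
  refine ⟨?_, h.integral_comp hf.aestronglyMeasurable⟩
  rw [← h.map_eq] at hf
  exact hf.comp_aemeasurable h.aemeasurable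

lemma integral_norm_sq_noise (he : HasLaw e (stdGaussian (EuclideanSpace ℝ (Fin n))) P) :
    Integrable (fun ω => ‖e ω‖ ^ 2) P ∧ ∫ ω, ‖e ω‖ ^ 2 ∂P = n := by
  have h := integral_noise_projection he ⊤ (d := n) (k := 0)
    (by rw [finrank_top, finrank_euclideanSpace_fin]) (by simp)
    ((integrable_id_chiSq n).comp_fst (chiSq 0))
  have h2 := integral_fun_fst (μ := chiSq n) (ν := chiSq 0) (fun u : ℝ => u)
  simp only [Submodule.starProjection_top, ContinuousLinearMap.id_apply] at h
  refine ⟨h.1, h.2.trans (h2.trans ?_)⟩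
  rw [integral_id_chiSq]
  simp

end Noise

/-! ### The oracle inequality -/

section Oracle

variable {n : ℕ} {Ω : Type*} [MeasurableSpace Ω] {P : Measure Ω} [IsProbabilityMeasure P]
  {e : Ω → EuclideanSpace ℝ (Fin n)}

/-- Bias-variance decomposition: the cross term is linear in the noise, hence centred. -/
lemma integral_residual (he : HasLaw e (stdGaussian (EuclideanSpace ℝ (Fin n))) P)
    (S : Submodule ℝ (EuclideanSpace ℝ (Fin n))) (μ : EuclideanSpace ℝ (Fin n)) (σ : ℝ) :
    Integrable (fun ω => ‖μ + σ • e ω - S.starProjection (μ + σ • e ω)‖ ^ 2) P ∧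
      ∫ ω, ‖μ + σ • e ω - S.starProjection (μ + σ • e ω)‖ ^ 2 ∂P =
        ‖μ - S.starProjection μ‖ ^ 2 + σ ^ 2 * modelCodim S := by
  set a := μ - S.starProjection μ with ha
  have hdim := modelDim_add_modelCodim S
  have hexp (ω : Ω) : ‖μ + σ • e ω - S.starProjection (μ + σ • e ω)‖ ^ 2 =
      ‖a‖ ^ 2 + 2 * σ * inner ℝ a (e ω) + σ ^ 2 * ‖e ω - S.starProjection (e ω)‖ ^ 2 := by
    have h1 : μ + σ • e ω - S.starProjection (μ + σ • e ω) =
        a + σ • (e ω - S.starProjection (e ω)) := by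
      rw [map_add, map_smul, ha, smul_sub]; abel
    have h2 : inner ℝ a (S.starProjection (e ω)) = 0 :=
      S.starProjection_inner_eq_zero μ _ (S.starProjection_apply_mem _)
    rw [h1, norm_add_sq_real, inner_smul_right, inner_sub_right, h2, norm_smul, mul_pow,
      Real.norm_eq_abs, sq_abs]
    ring
  have h1 := integral_noise_projection he S (d := modelDim S) rfl hdim
    ((integrable_id_chiSq (modelCodim S)).comp_snd (chiSq (modelDim S)))
  have h1' := integral_fun_snd (μ := chiSq (modelDim S)) (ν := chiSq (modelCodim S))
    (fun u : ℝ => u)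
  rw [integral_id_chiSq] at h1'
  have h2 : Integrable (fun ω => inner ℝ a (e ω)) P := by
    have : Integrable (fun v => innerSL ℝ a v) (stdGaussian (EuclideanSpace ℝ (Fin n))) :=
      (innerSL ℝ a).integrable_comp IsGaussian.integrable_id
    rw [← he.map_eq] at this
    exact this.comp_aemeasurable he.aemeasurable
  have h3 : ∫ ω, inner ℝ a (e ω) ∂P = 0 :=
    (he.integral_comp (f := innerSL ℝ a) (by fun_prop)).trans
      (integral_strongDual_stdGaussian (innerSL ℝ a))
  simp only [hexp]
  have h4 : Integrable (fun ω => ‖a‖ ^ 2 + 2 * σ * inner ℝ a (e ω)) P :=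
    (integrable_const _).add (h2.const_mul _)
  refine ⟨h4.add (h1.1.const_mul _), ?_⟩
  rw [integral_add h4 (h1.1.const_mul _), integral_add (integrable_const _) (h2.const_mul _),
    integral_const_mul, integral_const_mul, h3, h1.2, h1']
  simp

omit [IsProbabilityMeasure P] in
/-- The excess of the noise in the direction of a model over its penalty, in expectation. -/
lemma integral_excess (he : HasLaw e (stdGaussian (EuclideanSpace ℝ (Fin n))) P)
    (S T : Submodule ℝ (EuclideanSpace ℝ (Fin n)))
    (hT : Module.finrank ℝ T = Module.finrank ℝ S + 1) (hN : 1 ≤ modelCodim S) (x : ℝ) :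
    Integrable (fun ω => max (‖T.starProjection (e ω)‖ ^ 2 -
        x * (‖e ω - T.starProjection (e ω)‖ ^ 2 / (modelCodim S - 1 : ℕ))) 0) P ∧
      ∫ ω, max (‖T.starProjection (e ω)‖ ^ 2 -
        x * (‖e ω - T.starProjection (e ω)‖ ^ 2 / (modelCodim S - 1 : ℕ))) 0 ∂P =
      (modelDim S + 1) * Dkhi (modelDim S + 1) (modelCodim S - 1) x := by
  have hdim := modelDim_add_modelCodim S
  have h := integral_noise_projection he T (d := modelDim S + 1) (k := modelCodim S - 1) hT
    (by omega) (integrable_max_chiSq _ _ x)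
  refine ⟨h.1, h.2.trans ?_⟩
  rw [integral_max_chiSq _ _ (by omega)]
  push_cast
  rfl

/-- The loss of the selected estimator, compared with the criterion of an arbitrary model. -/
lemma loss_le_crit_add {S S₀ T : Submodule ℝ (EuclideanSpace ℝ (Fin n))} (hST : S ≤ T)
    {μ : EuclideanSpace ℝ (Fin n)} (hμ : μ ∈ T) (v : EuclideanSpace ℝ (Fin n)) {σ K L p₀ : ℝ}
    (hσ : 0 < σ) (hK : 1 < K) (hN : 2 ≤ modelCodim S) (hpen : 0 ≤ penKL K S L)
    (hcrit : crit S (penKL K S L) (μ + σ • v) ≤ crit S₀ p₀ (μ + σ • v)) :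
    (1 - 1 / K) * (‖μ - S.starProjection (μ + σ • v)‖ ^ 2 / σ ^ 2) ≤
      crit S₀ p₀ (μ + σ • v) / σ ^ 2 - ‖v‖ ^ 2 +
        K * max (‖T.starProjection v‖ ^ 2 -
          EDkhi (modelDim S + 1) (modelCodim S - 1) (Real.exp (-L)) *
            (‖v - T.starProjection v‖ ^ 2 / (modelCodim S - 1 : ℕ))) 0 := by
  set x := EDkhi (modelDim S + 1) (modelCodim S - 1) (Real.exp (-L)) with hx
  set Y := μ + σ • v with hY
  have hN' : (2 : ℝ) ≤ modelCodim S := by exact_mod_cast hN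
  have hcast : ((modelCodim S - 1 : ℕ) : ℝ) = modelCodim S - 1 := by
    rw [Nat.cast_sub (by omega), Nat.cast_one]
  -- The factor `N / (N - 1)` in the penalty turns division by `N` in the criterion into the
  -- division by `N - 1` required by `Dkhi`.
  have hratio : penKL K S L / modelCodim S = K * x / (modelCodim S - 1) := by
    have h1 : (modelCodim S : ℝ) - 1 ≠ 0 := by linarith
    have h2 : (modelCodim S : ℝ) ≠ 0 := by linarith
    rw [penKL, ← hx]
    field_simp
  have hratio0 : 0 ≤ penKL K S L / modelCodim S := by positivity
  -- Projecting on the larger space `T` lowers the residual, and `μ ∈ T` removes the mean from it.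
  have hres : σ ^ 2 * ‖v - T.starProjection v‖ ^ 2 ≤ ‖Y - S.starProjection Y‖ ^ 2 := by
    have h1 : Y - T.starProjection Y = σ • (v - T.starProjection v) := by
      rw [hY, map_add, map_smul, Submodule.starProjection_eq_self_iff.2 hμ, smul_sub]
      abel
    have h2 := norm_sub_starProjection_sq_le T Y (hST (S.starProjection_apply_mem Y))
    rwa [h1, norm_smul, mul_pow, Real.norm_eq_abs, sq_abs] at h2
  have hloss := loss_le_residual_add (σ := σ) hST hμ v hK
  rw [← hY] at hloss
  have hcrit' : ‖Y - S.starProjection Y‖ ^ 2 +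
      σ ^ 2 * ‖v - T.starProjection v‖ ^ 2 * (penKL K S L / modelCodim S) ≤ crit S₀ p₀ Y := by
    have h1 := mul_le_mul_of_nonneg_right hres hratio0
    have h2 : crit S (penKL K S L) Y = ‖Y - S.starProjection Y‖ ^ 2 +
        ‖Y - S.starProjection Y‖ ^ 2 * (penKL K S L / modelCodim S) := by
      rw [crit]; ring
    linarith
  have hσ2 : 0 < σ ^ 2 := by positivity
  have hmax := mul_le_mul_of_nonneg_left (le_max_left (‖T.starProjection v‖ ^ 2 -
    x * (‖v - T.starProjection v‖ ^ 2 / (modelCodim S - 1 : ℕ))) 0) (show 0 ≤ K by linarith)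
  refine le_trans ?_ (add_le_add_right hmax _)
  rw [hcast, ← mul_div_assoc, div_le_iff₀ hσ2, add_mul,
    sub_mul (crit S₀ p₀ Y / σ ^ 2), div_mul_cancel₀ _ hσ2.ne']
  rw [hratio] at hcrit'
  have h3 : K * (‖T.starProjection v‖ ^ 2 - x * (‖v - T.starProjection v‖ ^ 2 /
      (modelCodim S - 1))) * σ ^ 2 = K * (σ ^ 2 * ‖T.starProjection v‖ ^ 2) -
      σ ^ 2 * ‖v - T.starProjection v‖ ^ 2 * (K * x / (modelCodim S - 1)) := by ring
  rw [h3]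
  linarith

end Oracle

lemma observation_eq_add_smul {n : ℕ} {Ω : Type*} (μ : EuclideanSpace ℝ (Fin n)) (σ : ℝ)
    (ε : Fin n → Ω → ℝ) (ω : Ω) :
    observation μ σ ε ω = μ + σ • WithLp.toLp 2 (fun i => ε i ω) := by
  ext i
  simp [observation]

theorem corollary1 (K : ℝ) (hK : 1 < K) (κ : ℝ) (hκ : κ < 1) :
    ∃ C : ℝ, 0 < C ∧
      ∀ (n : ℕ) (M : Type*) (_ : Countable M)
        (S : M → Submodule ℝ (EuclideanSpace ℝ (Fin n))) (L : M → ℝ),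
        (∀ m, 0 ≤ L m) →
        Summable (fun m => ((modelDim (S m) : ℝ) + 1) * Real.exp (-L m)) →
        (∀ m, 7 ≤ modelCodim (S m)) →
        (∀ m, max (L m) (modelDim (S m) : ℝ) ≤ κ * n) →
        ∀ (Ω : Type*) (_ : MeasurableSpace Ω) (P : Measure Ω) (_ : IsProbabilityMeasure P)
          (μ : EuclideanSpace ℝ (Fin n)) (σ : ℝ) (_ : 0 < σ) (ε : Fin n → Ω → ℝ),
          (∀ i, HasLaw (ε i) (gaussianReal 0 1) P) →
          iIndepFun ε P →
          ∀ mhat : Ω → M,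
            (∀ m, MeasurableSet (mhat ⁻¹' {m})) →
            (∀ᵐ ω ∂P, ∀ m,
              crit (S (mhat ω)) (penKL K (S (mhat ω)) (L (mhat ω))) (observation μ σ ε ω) ≤
                crit (S m) (penKL K (S m) (L m)) (observation μ σ ε ω)) →
            Integrable (fun ω =>
              ‖μ - (S (mhat ω)).starProjection (observation μ σ ε ω)‖ ^ 2 / σ ^ 2) P ∧
            ∫ ω, ‖μ - (S (mhat ω)).starProjection (observation μ σ ε ω)‖ ^ 2 / σ ^ 2 ∂P ≤
              C * ((⨅ m, (‖μ - (S m).starProjection μ‖ ^ 2 / σ ^ 2 +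
                    max (modelDim (S m) : ℝ) (L m))) +
                  ∑' m, ((modelDim (S m) : ℝ) + 1) * Real.exp (-L m)) := by
  have hK0 : 0 < K := by linarith
  have hκ' : 0 < 1 - κ := by linarith
  have hα : 0 < 1 - 1 / K := by
    rw [sub_pos, div_lt_one hK0]
    exact hK
  set α := 1 - 1 / K
  set B := 8 * K * Real.exp (7 / (1 - κ)) with hB
  set G := B * (3 / (1 - κ)) with hG
  have hB0 : 0 < B := by positivity
  have hG0 : 0 < G := by positivity
  -- The final bound has coefficients `1 + G` on the bias, `4B` on `max D_m L_m` and `6B + K` on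
  -- `Σ'`; the numerator dominates all three.
  refine ⟨(1 + G + 6 * B + K) / α, by positivity, ?_⟩
  intro n M _ S L hL hsum hN hmax Ω _ P _ μ σ hσ ε hε hind mhat hmhat hmin
  have he := hasLaw_stdGaussian_of_iIndepFun hε hind
  simp only [observation_eq_add_smul] at hmin ⊢
  set e : Ω → EuclideanSpace ℝ (Fin n) := fun ω => WithLp.toLp 2 fun i => ε i ω with he_def
  have hmin' : ∀ᵐ ω ∂P, ∀ m,
      crit (S (mhat ω)) (penKL K (S (mhat ω)) (L (mhat ω))) (μ + σ • e ω) ≤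
        crit (S m) (penKL K (S m) (L m)) (μ + σ • e ω) := hmin
  change Integrable (fun ω => ‖μ - (S (mhat ω)).starProjection (μ + σ • e ω)‖ ^ 2 / σ ^ 2) P ∧
    ∫ ω, ‖μ - (S (mhat ω)).starProjection (μ + σ • e ω)‖ ^ 2 / σ ^ 2 ∂P ≤ _
  clear_value e
  clear hmin he_def
  obtain ⟨ω₀⟩ := nonempty_of_isProbabilityMeasure P
  have : Nonempty M := ⟨mhat ω₀⟩
  have hpen m := penKL_spec (S m) hK hκ (hL m) (hN m) (hmax m)
  have hT (m : M) : ∃ T : Submodule ℝ (EuclideanSpace ℝ (Fin n)), S m ≤ T ∧ μ ∈ T ∧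
      Module.finrank ℝ T = Module.finrank ℝ (S m) + 1 := by
    refine exists_le_mem_finrank_eq_add_one (S m) ?_ μ
    have h1 := modelDim_add_modelCodim (S m)
    have h2 := hN m
    rw [finrank_euclideanSpace_fin]
    rw [modelDim] at h1
    omega
  choose T hST hμT hTdim using hT
  set V : M → Ω → ℝ := fun m ω => K * max (‖(T m).starProjection (e ω)‖ ^ 2 -
    EDkhi (modelDim (S m) + 1) (modelCodim (S m) - 1) (Real.exp (-L m)) *
      (‖e ω - (T m).starProjection (e ω)‖ ^ 2 / (modelCodim (S m) - 1 : ℕ))) 0 with hV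
  have hVint m : Integrable (V m) P :=
    ((integral_excess he (S m) (T m) (hTdim m) (by have := hN m; omega) _).1).const_mul K
  have hVval m : ∫ ω, V m ω ∂P = K * ((modelDim (S m) + 1) * Real.exp (-L m)) := by
    rw [hV]
    simp only
    rw [integral_const_mul,
      (integral_excess he (S m) (T m) (hTdim m) (by have := hN m; omega) _).2, (hpen m).2.2.2]
  obtain ⟨hVs, hVle⟩ := integrable_select_and_integral_le hmhat hVint
    (fun m ω => mul_nonneg hK0.le (le_max_right _ _)) (by simpa only [hVval] using hsum.mul_left K)
  simp only [hVval, tsum_mul_left] at hVle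
  set Sig := ∑' m, ((modelDim (S m) : ℝ) + 1) * Real.exp (-L m) with hSig
  have hlossmeas : AEStronglyMeasurable
      (fun ω => ‖μ - (S (mhat ω)).starProjection (μ + σ • e ω)‖ ^ 2 / σ ^ 2) P := by
    have hea := he.aemeasurable
    exact (aemeasurable_select
      (f := fun m ω => ‖μ - (S m).starProjection (μ + σ • e ω)‖ ^ 2 / σ ^ 2) hmhat
      fun m => by fun_prop).aestronglyMeasurable
  have hbound (m : M) : ∀ᵐ ω ∂P,
      ‖μ - (S (mhat ω)).starProjection (μ + σ • e ω)‖ ^ 2 / σ ^ 2 ≤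
        α⁻¹ * (crit (S m) (penKL K (S m) (L m)) (μ + σ • e ω) / σ ^ 2 - ‖e ω‖ ^ 2 +
          V (mhat ω) ω) := by
    filter_upwards [hmin'] with ω hω
    rw [inv_mul_eq_div, le_div_iff₀' hα]
    exact loss_le_crit_add (hST _) (hμT _) (e ω) hσ hK (by have := hN (mhat ω); omega)
      (hpen _).1 (hω m)
  have hcrit (m : M) := (integral_residual he (S m) μ σ)
  have hnoise := integral_norm_sq_noise he
  have hcritint (m : M) :
      Integrable (fun ω => crit (S m) (penKL K (S m) (L m)) (μ + σ • e ω) / σ ^ 2) P :=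
    ((hcrit m).1.mul_const _).div_const _
  have hdiff (m : M) : Integrable (fun ω =>
      crit (S m) (penKL K (S m) (L m)) (μ + σ • e ω) / σ ^ 2 - ‖e ω‖ ^ 2) P :=
    (hcritint m).sub hnoise.1
  have hRint (m : M) : Integrable (fun ω => α⁻¹ *
      (crit (S m) (penKL K (S m) (L m)) (μ + σ • e ω) / σ ^ 2 - ‖e ω‖ ^ 2 + V (mhat ω) ω)) P :=
    ((hdiff m).add hVs).const_mul _
  have hloss : Integrable
      (fun ω => ‖μ - (S (mhat ω)).starProjection (μ + σ • e ω)‖ ^ 2 / σ ^ 2) P := by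
    refine (hRint (mhat ω₀)).mono' hlossmeas ?_
    filter_upwards [hbound (mhat ω₀)] with ω hω
    rwa [Real.norm_of_nonneg (by positivity)]
  refine ⟨hloss, ?_⟩
  have hSig0 (m : M) : ((modelDim (S m) : ℝ) + 1) * Real.exp (-L m) ≤ Sig :=
    hsum.le_tsum m fun j _ => by positivity
  -- The infimum is isolated on one side, so that it suffices to prove the bound for each competitor
  -- `m`.
  rw [div_mul_eq_mul_div, le_div_iff₀' hα, ← div_le_iff₀' (by positivity), ← sub_le_iff_le_add]
  refine le_ciInf fun m => ?_
  rw [sub_le_iff_le_add, div_le_iff₀' (by positivity)]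
  have hI := integral_mono_ae hloss (hRint m) (hbound m)
  rw [integral_const_mul, integral_add (hdiff m) hVs,
    integral_sub (hcritint m) hnoise.1, hnoise.2, inv_mul_eq_div, le_div_iff₀' hα] at hI
  have hcritval : ∫ ω, crit (S m) (penKL K (S m) (L m)) (μ + σ • e ω) / σ ^ 2 ∂P =
      (‖μ - (S m).starProjection μ‖ ^ 2 / σ ^ 2 + modelCodim (S m)) *
        (1 + penKL K (S m) (L m) / modelCodim (S m)) := by
    simp only [crit]
    rw [integral_div, integral_mul_const, (hcrit m).2]
    field_simp
  rw [hcritval] at hI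
  obtain ⟨hp0, hp1, hp2, -⟩ := hpen m
  rw [← hB] at hp1
  rw [← hB, ← hG] at hp2
  have hdim : (modelDim (S m) : ℝ) + modelCodim (S m) = n := by
    exact_mod_cast modelDim_add_modelCodim (S m)
  have hN7 : (7 : ℝ) ≤ modelCodim (S m) := by exact_mod_cast hN m
  have hD0 : (0 : ℝ) ≤ modelDim (S m) := by positivity
  have hpN : modelCodim (S m) * (penKL K (S m) (L m) / modelCodim (S m)) = penKL K (S m) (L m) :=
    mul_div_cancel₀ _ (by linarith)
  have hb0 : 0 ≤ ‖μ - (S m).starProjection μ‖ ^ 2 / σ ^ 2 := by positivity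
  generalize ‖μ - (S m).starProjection μ‖ ^ 2 / σ ^ 2 = b at *
  set A := max (modelDim (S m) : ℝ) (L m) with hA
  have hDA : (modelDim (S m) : ℝ) ≤ A := le_max_left _ _
  have hLA : L m ≤ A := le_max_right _ _
  -- The additive `2` in the penalty bound is not controlled by `A` alone, which may vanish. If `L m
  -- < 1`, however, `Sig ≥ exp (-1) ≥ 1/3`.
  have hone : 1 ≤ A + 3 * Sig := by
    have h1 : 0 ≤ Sig := le_trans (by positivity) (hSig0 m)
    rcases le_or_gt 1 (L m) with h | h
    · linarith
    · have h2 : Real.exp (-1) ≤ Real.exp (-L m) := Real.exp_le_exp.2 (by linarith)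
      have h3 : 1 / 3 ≤ Real.exp (-1) := by
        rw [Real.exp_neg, ← one_div]
        exact one_div_le_one_div_of_le (Real.exp_pos _) Real.exp_one_lt_three.le
      have h4 := hSig0 m
      have h5 : Real.exp (-L m) ≤ ((modelDim (S m) : ℝ) + 1) * Real.exp (-L m) := by
        nlinarith [Real.exp_pos (-L m)]
      linarith
  have hSig_nn : 0 ≤ Sig := le_trans (by positivity) (hSig0 m)
  have hA0 : 0 ≤ A := hD0.trans hDA
  -- `L + D + 2 ≤ 2A + 2(A + 3 Sig)`.
  have hpenA : penKL K (S m) (L m) ≤ B * (4 * A + 6 * Sig) :=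
    hp1.trans (mul_le_mul_of_nonneg_left (by linarith) hB0.le)
  have hbias := mul_le_mul_of_nonneg_left hp2 hb0
  have hexpand : (b + modelCodim (S m)) * (1 + penKL K (S m) (L m) / modelCodim (S m)) =
      b + b * (penKL K (S m) (L m) / modelCodim (S m)) + modelCodim (S m) +
        penKL K (S m) (L m) := by
    linear_combination hpN
  rw [hexpand] at hI
  -- The slack between the coefficients obtained and the common constant; the term `modelCodim (S m)
  -- - n = -modelDim (S m)` is nonpositive and dropped.
  have h1 : 0 ≤ (6 * B + K) * b := by positivity
  have h2 : 0 ≤ (1 + G + 2 * B + K) * A := by positivity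
  have h3 : 0 ≤ (1 + G) * Sig := by positivity
  linarith
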